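/- A real polynomial $f$ of degree $d$ is called magic positive if all coefficients $b_0,\dots,b_d$ in its expansion $f(x)=\sum_{i=0}^{d} b_i\,x^i(x+1)^{d-i}$ are nonnegative. For a lattice polytope $P\subset\mathbb{R}^N$ let $E_P$ be its Ehrhart polynomial, i.e. the polynomial with $E_P(m)=|mP\cap\mathbb{Z}^N|$ for all integers $m>0$, and put $$\operatorname{m-index}(P)=\min\{k\in\mathbb{Z}_{>0} : E_{kP}\text{ is magic positive}\}.$$ For a matroid $M$ on a finite ground set $E$, the base polytope $B(M)\subset\mathbb{R}^E$ is the convex hull of the indicator vectors $e_B=\sum_{b\in B}e_b$ of the bases $B$ of $M$. The matroid $M$ is connected if any two distinct elements of $E$ lie in a common circuit. A minimal matroid $T_{k,n}$ is a connected matroid of rank $k$ on $n$ elements with exactly $k(n-k)+1$ bases (the smallest possible number; such a matroid is unique up to isomorphism). Then: (1) For every $n\ge 2$, a minimal matroid $T_{1,n}$ exists, and every such matroid satisfies $\operatorname{m-index}(B(T_{1,n}))=n-1$. (2) For every $n\ge 4$, a minimal matroid $T_{2,n}$ exists, and every such matroid satisfies $\operatorname{m-index}(B(T_{2,n}))=n-2$.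 -/

import Mathlib

open scoped Pointwise

universe u

/-- A real polynomial `f` of degree `d` is magic positive if its coefficients `b 0, …, b d` in the
basis `x ^ i * (x + 1) ^ (d - i)`, `0 ≤ i ≤ d`, of the polynomials of degree at most `d` are all
nonnegative. -/
def MagicPositive (f : Polynomial ℝ) : Prop :=
  ∃ b : ℕ → ℝ, (∀ i ≤ f.natDegree, 0 ≤ b i) ∧
    f = ∑ i ∈ Finset.range (f.natDegree + 1),
      Polynomial.C (b i) * Polynomial.X ^ i * (Polynomial.X + 1) ^ (f.natDegree - i)

/-- The number of points of the integer lattice in a subset of `ℝ ^ ι`. -/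
noncomputable def latticePointCount {ι : Type*} (P : Set (ι → ℝ)) : ℕ :=
  {z : ι → ℤ | (fun i => (z i : ℝ)) ∈ P}.ncard

/-- `f` is the Ehrhart polynomial of `P`: for every integer `n > 0`, `f n` is the number of lattice
points of the dilate `n P`. -/
def IsEhrhartPolynomial {ι : Type*} (P : Set (ι → ℝ)) (f : Polynomial ℝ) : Prop :=
  ∀ n : ℕ, 0 < n → f.eval (n : ℝ) = (latticePointCount ((n : ℝ) • P) : ℝ)

/-- The Ehrhart polynomial is unique, so that it makes sense to speak of "the" polynomial. -/
theorem IsEhrhartPolynomial.unique {ι : Type*} {P : Set (ι → ℝ)} {f g : Polynomial ℝ}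
    (hf : IsEhrhartPolynomial P f) (hg : IsEhrhartPolynomial P g) : f = g := by
  refine Polynomial.eq_of_infinite_eval_eq f g (Set.Infinite.mono ?_
    ((Set.Ioi_infinite (0 : ℕ)).image (Nat.cast_injective (R := ℝ)).injOn))
  rintro _ ⟨n, hn, rfl⟩
  exact (hf n hn).trans (hg n hn).symm

/-- The m-index of `P`: the least positive integer `k` such that the Ehrhart polynomial of the
dilate `k P` is magic positive (with the value `0` if there is no such `k`). -/
noncomputable def mIndex {ι : Type*} (P : Set (ι → ℝ)) : ℕ :=
  sInf {k : ℕ | 0 < k ∧ ∃ f : Polynomial ℝ, IsEhrhartPolynomial ((k : ℝ) • P) f ∧ MagicPositive f}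

/-- A matroid is connected if any two distinct elements of its ground set lie in a common
circuit. -/
def MatroidConnected {α : Type*} (M : Matroid α) : Prop :=
  ∀ x ∈ M.E, ∀ y ∈ M.E, x ≠ y → ∃ C, M.IsCircuit C ∧ x ∈ C ∧ y ∈ C

/-- `M` is a minimal matroid `T_{k,n}`: a connected matroid of rank `k` on `n` elements having
exactly `k (n - k) + 1` bases, the least possible number. -/
structure IsMinimalMatroid {α : Type*} (M : Matroid α) (k n : ℕ) : Prop where
  card_ground : M.E.encard = n
  rank_eq : M.eRank = k
  connected : MatroidConnected M
  card_bases : {B : Set α | M.IsBase B}.ncard = k * (n - k) + 1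

/-- The base polytope of `M` in `ℝ ^ E`, `E` the ground set: the convex hull of the indicator
vectors of the bases. -/
noncomputable def basePolytope {α : Type*} (M : Matroid α) : Set (M.E → ℝ) :=
  convexHull ℝ {v | ∃ B : Set α, M.IsBase B ∧ v = Set.indicator {e : M.E | (e : α) ∈ B} 1}

/-! Both Ehrhart polynomials split as `∏ (a_j x + 1)` with all `a_j > 0`, and dilating by `k`
replaces `a_j` by `k a_j`. If every `k a_j ≥ 1`, each factor is `(k a_j - 1) x + (x + 1)`, and the
product is magic positive. If some `k a_j < 1`, there is a root `-1 / (k a_j) < -1`, where a nonzero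
magic positive polynomial cannot vanish. So the m-index is the least `k` with `k * min a_j ≥ 1`
(`mIndex_eq_of_prod`).

In rank one the base polytope is the standard simplex, with lattice count `(m + n - 1).choose (n -
1)` and slopes `1, 1/2, …, 1/(n-1)`.

In rank two the bases are the edges of a graph. Exchange makes it complete multipartite,
connectedness gives a triangle, and the base count bounds the edges by `2n - 3`; together these
force two adjacent vertices joined to everything. The lattice count is then `(m + n - 2).choose (n -
2)` times `(n-2)/(n-1) * m + 1`, whose smallest slope is `1/(n-2)` once `n ≥ 4`. -/

/-! ### Magic positivity, roots and the m-index -/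

/-- A product of linear factors `p j * x + q j * (x + 1)` with nonnegative `p j`, `q j`, not
vanishing at infinity, is magic positive. -/
theorem magicPositive_prod {κ : Type*} (s : Finset κ) (p q : κ → ℝ) (hp : ∀ j ∈ s, 0 ≤ p j)
    (hq : ∀ j ∈ s, 0 ≤ q j) (hpq : ∀ j ∈ s, p j + q j ≠ 0) :
    MagicPositive (∏ j ∈ s, (Polynomial.C (p j + q j) * Polynomial.X + Polynomial.C (q j))) := by
  classical
  have hdeg : (∏ j ∈ s, (Polynomial.C (p j + q j) * Polynomial.X
      + Polynomial.C (q j))).natDegree = s.card := by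
    rw [Polynomial.natDegree_prod, Finset.card_eq_sum_ones]
    · exact Finset.sum_congr rfl fun j hj => Polynomial.natDegree_linear (hpq j hj)
    · intro j hj h0
      have := Polynomial.natDegree_linear (b := q j) (hpq j hj)
      rw [h0] at this
      simp at this
  refine ⟨fun i => ∑ t ∈ s.powersetCard i, (∏ j ∈ t, p j) * ∏ j ∈ s \ t, q j, ?_, ?_⟩
  · intro i _
    refine Finset.sum_nonneg fun t ht => mul_nonneg ?_ ?_
    · exact Finset.prod_nonneg fun j hj => hp j ((Finset.mem_powersetCard.1 ht).1 hj)
    · exact Finset.prod_nonneg fun j hj => hq j (Finset.sdiff_subset hj)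
  · rw [hdeg]
    have h1 : ∀ j ∈ s, Polynomial.C (p j + q j) * Polynomial.X + Polynomial.C (q j)
        = Polynomial.C (p j) * Polynomial.X + Polynomial.C (q j) * (Polynomial.X + 1) := by
      intro j _
      rw [Polynomial.C_add]; ring
    rw [Finset.prod_congr rfl h1, Finset.prod_add, Finset.sum_powerset]
    refine Finset.sum_congr rfl fun i _ => ?_
    rw [map_sum, Finset.sum_mul, Finset.sum_mul]
    refine Finset.sum_congr rfl fun t ht => ?_
    obtain ⟨hts, hti⟩ := Finset.mem_powersetCard.1 ht
    rw [Finset.prod_mul_distrib, Finset.prod_mul_distrib, Finset.prod_const, Finset.prod_const,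
      Finset.card_sdiff_of_subset hts, hti, map_mul, map_prod, map_prod]
    ring

/-- A nonzero magic positive polynomial has no root smaller than `-1`. -/
theorem MagicPositive.eval_ne_zero {f : Polynomial ℝ} (hf : MagicPositive f) (h0 : f ≠ 0) {x : ℝ}
    (hx : x < -1) : f.eval x ≠ 0 := by
  obtain ⟨b, hb, hfb⟩ := hf
  intro hfx
  apply h0
  have hx1 : x + 1 ≠ 0 := by linarith
  -- With `t = x / (x + 1)`, `f x = (x + 1) ^ d * ∑ b i * t ^ i`. Since `t > 0`, a vanishing sum
  -- kills every `b i`.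
  have ht : 0 < x / (x + 1) := div_pos_of_neg_of_neg (by linarith) (by linarith)
  have hsum : ∑ i ∈ Finset.range (f.natDegree + 1), b i * (x / (x + 1)) ^ i = 0 := by
    have h2 : f.eval x = (x + 1) ^ f.natDegree *
        ∑ i ∈ Finset.range (f.natDegree + 1), b i * (x / (x + 1)) ^ i := by
      conv_lhs => rw [hfb]
      rw [Polynomial.eval_finsetSum, Finset.mul_sum]
      refine Finset.sum_congr rfl fun i hi => ?_
      have hi' : i ≤ f.natDegree := by simpa [Nat.lt_succ_iff] using hi
      simp only [Polynomial.eval_mul, Polynomial.eval_C, Polynomial.eval_pow, Polynomial.eval_X,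
        Polynomial.eval_add, Polynomial.eval_one]
      rw [div_pow, ← Nat.sub_add_cancel hi', Nat.add_sub_cancel, pow_add]
      field_simp
    rw [hfx] at h2
    exact (mul_eq_zero.1 h2.symm).resolve_left (pow_ne_zero _ hx1)
  have hall := (Finset.sum_eq_zero_iff_of_nonneg fun i hi =>
    mul_nonneg (hb i (by simpa [Nat.lt_succ_iff] using hi)) (pow_pos ht i).le).1 hsum
  rw [hfb]
  refine Finset.sum_eq_zero fun i hi => ?_
  rw [(mul_eq_zero.1 (hall i hi)).resolve_right (pow_pos ht i).ne']
  simp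

/-- The m-index of a polytope whose Ehrhart polynomial is `∏ j, (a j * x + 1)` is the least
positive integer `K` with `1 ≤ K * a j` for all `j`. -/
theorem mIndex_eq_of_prod {ι κ : Type*} (P : Set (ι → ℝ)) (s : Finset κ) (a : κ → ℝ)
    (hP : ∀ m : ℕ, 0 < m → (latticePointCount ((m : ℝ) • P) : ℝ) = ∏ j ∈ s, (a j * m + 1))
    {K : ℕ} (hK : 0 < K) (hle : ∀ j ∈ s, 1 ≤ K * a j) {j₀ : κ} (hj₀ : j₀ ∈ s)
    (hlt : ∀ k : ℕ, k < K → k * a j₀ < 1) : mIndex P = K := by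
  have hpos : ∀ j ∈ s, 0 < a j := fun j hj =>
    pos_of_mul_pos_right (zero_lt_one.trans_le (hle j hj)) (Nat.cast_nonneg K)
  have hE : ∀ k : ℕ, 0 < k → IsEhrhartPolynomial ((k : ℝ) • P)
      (∏ j ∈ s, (Polynomial.C (k * a j) * Polynomial.X + Polynomial.C 1)) := by
    intro k hk m hm
    rw [smul_smul, ← Nat.cast_mul, hP _ (Nat.mul_pos hm hk), Polynomial.eval_prod]
    refine Finset.prod_congr rfl fun j _ => ?_
    simp
    ring
  have hmem : K ∈ {k : ℕ | 0 < k ∧ ∃ f : Polynomial ℝ,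
      IsEhrhartPolynomial ((k : ℝ) • P) f ∧ MagicPositive f} := by
    refine ⟨hK, _, hE K hK, ?_⟩
    -- Uses `K a x + 1 = (K a - 1) x + 1 * (x + 1)`.
    have := magicPositive_prod s (fun j => K * a j - 1) (fun _ => 1)
      (fun j hj => sub_nonneg.2 (hle j hj)) (fun _ _ => zero_le_one)
      (fun j hj => by have := hle j hj; simp only [sub_add_cancel]; linarith)
    simpa using this
  refine le_antisymm (Nat.sInf_le hmem) (le_csInf ⟨K, hmem⟩ ?_)
  rintro k ⟨hk, f, hf, hfm⟩
  by_contra! hkK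
  rw [hf.unique (hE k hk)] at hfm
  have hk' : (0 : ℝ) < k := by exact_mod_cast hk
  have hka : 0 < k * a j₀ := mul_pos hk' (hpos _ hj₀)
  refine hfm.eval_ne_zero ?_ (x := -(1 / (k * a j₀))) ?_ ?_
  · rw [Finset.prod_ne_zero_iff]
    intro j _ h
    simpa using congrArg (Polynomial.eval 0) h
  · rw [neg_lt_neg_iff, one_lt_div hka]
    exact hlt k hkK
  · rw [Polynomial.eval_prod]
    refine Finset.prod_eq_zero hj₀ ?_
    simp only [Polynomial.eval_add, Polynomial.eval_mul, Polynomial.eval_C, Polynomial.eval_X]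
    rw [mul_neg, mul_one_div_cancel hka.ne']
    ring

/-! ### Binomial identities -/

/-- The binomial coefficient `(m + d).choose d` as a product of linear factors in `m`. -/
theorem choose_add_eq_prod (m d : ℕ) :
    ((m + d).choose d : ℝ) = ∏ i ∈ Finset.range d, (1 / ((i : ℝ) + 1) * m + 1) := by
  induction d with
  | zero => simp
  | succ d ih =>
    rw [Finset.prod_range_succ, ← ih]
    have h := Nat.add_one_mul_choose_eq (m + d) d
    have h' : ((m + d : ℕ) + 1 : ℝ) * ((m + d).choose d : ℝ)
        = ((m + (d + 1)).choose (d + 1) : ℝ) * ((d : ℝ) + 1) := by exact_mod_cast h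
    have hd : (d : ℝ) + 1 ≠ 0 := by positivity
    push_cast at h'
    field_simp
    linarith

/-- Closed form of `∑ s ≤ m, (s + 1) * (s + r).choose r`. -/
theorem sum_succ_mul_choose (r m : ℕ) :
    ((∑ s ∈ Finset.range (m + 1), (s + 1) * (s + r).choose r : ℕ) : ℝ)
      = ((m + (r + 1)).choose (r + 1) : ℝ) * (((r : ℝ) + 1) / (r + 2) * m + 1) := by
  induction m with
  | zero => simp
  | succ m ih =>
    rw [Finset.sum_range_succ, Nat.cast_add, ih]
    have h1 : ((m + 1 + r).choose r : ℝ) * (m + 1)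
        = ((m + (r + 1)).choose (r + 1) : ℝ) * (r + 1) := by
      have h := Nat.choose_succ_right_eq (m + (r + 1)) r
      rw [show m + (r + 1) - r = m + 1 by omega] at h
      rw [show m + 1 + r = m + (r + 1) by ring]
      exact_mod_cast h.symm
    have h2 : ((m + 1 + (r + 1)).choose (r + 1) : ℝ)
        = ((m + 1 + r).choose r : ℝ) + ((m + (r + 1)).choose (r + 1) : ℝ) := by
      rw [show m + 1 + (r + 1) = (m + (r + 1)) + 1 by ring, Nat.choose_succ_succ,
        show m + 1 + r = m + (r + 1) by ring]
      push_cast; ring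
    rw [h2]
    have hr : (r : ℝ) + 2 ≠ 0 := by positivity
    push_cast
    field_simp
    linear_combination h1

/-! ### Lattice points of the two polytopes -/

theorem card_piAntidiag_eq_choose {ι : Type*} [DecidableEq ι] (s : Finset ι) {r : ℕ}
    (hs : s.card = r + 1) (n : ℕ) : (Finset.piAntidiag s n).card = (n + r).choose r := by
  have h : (Finset.piAntidiag s n).card = (Finset.finsuppAntidiag s n).card := by
    refine (Finset.card_nbij (fun f : ι →₀ ℕ => (f : ι → ℕ)) ?_
      DFunLike.coe_injective.injOn ?_).symm
    · intro f hf
      simp only [Finset.mem_coe, Finset.mem_finsuppAntidiag] at hf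
      simp only [Finset.mem_coe, Finset.mem_piAntidiag]
      exact ⟨hf.1, fun i hi => hf.2 (Finsupp.mem_support_iff.2 hi)⟩
    · intro g hg
      simp only [Finset.mem_coe, Finset.mem_piAntidiag] at hg
      refine ⟨Finsupp.onFinset s g hg.2, ?_, rfl⟩
      simp only [Finset.mem_coe, Finset.mem_finsuppAntidiag]
      exact ⟨hg.1, Finsupp.support_onFinset_subset⟩
  rw [h, Finset.card_finsuppAntidiag_nat_eq_choose, hs, show r + 1 + n - 1 = n + r by omega,
    Nat.choose_symm_add]

/-- The lattice points of the `m`-th dilate of the standard simplex. -/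
theorem latticePointCount_smul_stdSimplex {ι : Type*} [Fintype ι] {r : ℕ}
    (hι : Fintype.card ι = r + 1) {m : ℕ} (hm : 0 < m) :
    latticePointCount ((m : ℝ) • stdSimplex ℝ ι) = (m + r).choose r := by
  classical
  rw [← card_piAntidiag_eq_choose (Finset.univ : Finset ι) hι, ← Set.ncard_coe_finset,
    ← Set.ncard_image_of_injective (f := fun (g : ι → ℕ) (i : ι) => (g i : ℤ)) _
      (fun g g' h => funext fun i => Int.ofNat_inj.1 (congrFun h i))]
  have hm' : (0 : ℝ) < m := by exact_mod_cast hm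
  unfold latticePointCount
  congr 1
  ext z
  simp only [Set.mem_ofPred_eq, Set.mem_smul_set_iff_inv_smul_mem₀ hm'.ne', stdSimplex,
    Pi.smul_apply, smul_eq_mul, ← Finset.mul_sum, inv_mul_eq_one₀ hm'.ne',
    mul_nonneg_iff_of_pos_left (inv_pos.2 hm'), Set.mem_image, Finset.mem_coe,
    Finset.mem_piAntidiag]
  constructor
  · rintro ⟨h0, h1⟩
    have h0' : ∀ i, 0 ≤ z i := fun i => by exact_mod_cast h0 i
    have h1' : (m : ℤ) = ∑ i, z i := by exact_mod_cast h1
    refine ⟨fun i => (z i).toNat, ⟨?_, fun _ _ => Finset.mem_univ _⟩,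
      funext fun i => Int.toNat_of_nonneg (h0' i)⟩
    zify
    rw [h1']
    exact Finset.sum_congr rfl fun i _ => Int.toNat_of_nonneg (h0' i)
  · rintro ⟨g, ⟨hg, -⟩, rfl⟩
    refine ⟨fun i => by simp, ?_⟩
    rw [← hg]
    push_cast
    rfl

/-- The convex hull of the vectors `e i + e j`, `i ∈ {a, b}`, `j ≠ i`, in terms of inequalities. -/
theorem convexHull_single_add_single {ι : Type*} [Fintype ι] [DecidableEq ι] {a b : ι}
    (hab : a ≠ b) :
    convexHull ℝ {v : ι → ℝ | ∃ i j, i ≠ j ∧ (i = a ∨ i = b) ∧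
      v = Pi.single i 1 + Pi.single j 1} =
    {v | (∀ i, 0 ≤ v i) ∧ v a ≤ 1 ∧ v b ≤ 1 ∧ ∑ i, v i = 2 ∧ 1 ≤ v a + v b} := by
  apply Set.Subset.antisymm
  · refine convexHull_min ?_ ?_
    · rintro v ⟨i, j, hij, hi, rfl⟩
      have hle : ∀ k, (Pi.single i 1 + Pi.single j 1 : ι → ℝ) k ≤ 1 := by
        intro k
        rw [Pi.add_apply, Pi.single_apply, Pi.single_apply]
        split_ifs with h1 h2 h2
        · exact absurd (h1.symm.trans h2) hij
        all_goals norm_num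
      have hnn : ∀ k, 0 ≤ (Pi.single i 1 + Pi.single j 1 : ι → ℝ) k := by
        intro k
        rw [Pi.add_apply, Pi.single_apply, Pi.single_apply]
        split_ifs <;> norm_num
      refine ⟨hnn, hle a, hle b, ?_, ?_⟩
      · simp only [Pi.add_apply, Finset.sum_add_distrib, Finset.sum_pi_single', Finset.mem_univ,
          if_true]
        norm_num
      · have hi1 : 1 ≤ (Pi.single i 1 + Pi.single j 1 : ι → ℝ) i := by
          simp [hij]
        rcases hi with rfl | rfl
        · linarith [hnn b]
        · linarith [hnn a]
    · rintro x ⟨hx0, hxa, hxb, hxs, hxab⟩ y ⟨hy0, hya, hyb, hys, hyab⟩ s t hs ht hst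
      obtain rfl : t = 1 - s := by linarith
      simp only [Set.mem_ofPred_eq, Pi.add_apply, Pi.smul_apply, smul_eq_mul,
        Finset.sum_add_distrib, ← Finset.mul_sum, hxs, hys]
      refine ⟨fun i => ?_, ?_, ?_, by ring, ?_⟩
      · have := hx0 i
        have := hy0 i
        positivity
      all_goals nlinarith
  · rintro v ⟨h0, hva, hvb, hsum, hvab⟩
    set S : Set (ι → ℝ) := {v : ι → ℝ | ∃ i j, i ≠ j ∧ (i = a ∨ i = b) ∧
      v = Pi.single i 1 + Pi.single j 1} with hS
    have hconv := convex_convexHull ℝ S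
    have hmem : ∀ i j, i ≠ j → (i = a ∨ i = b) →
        (Pi.single i 1 + Pi.single j 1 : ι → ℝ) ∈ convexHull ℝ S :=
      fun i j h1 h2 => subset_convexHull ℝ S ⟨i, j, h1, h2, rfl⟩
    set R : Finset ι := Finset.univ \ {a, b} with hR
    have hRab : ∀ i ∈ R, i ≠ a ∧ i ≠ b := by
      intro i hi
      simpa [hR, not_or] using hi
    have hw : ∑ i ∈ R, v i = 2 - v a - v b := by
      have := Finset.sum_sdiff (Finset.subset_univ ({a, b} : Finset ι)) (f := v)
      rw [Finset.sum_pair hab, hsum] at this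
      linarith
    -- `w` is the mass of `v` off `{a, b}`. If it is zero, the bounds `v a, v b ≤ 1` force `v = e_a
    -- + e_b`.
    set w : ℝ := 2 - v a - v b with hwdef
    have hw0 : 0 ≤ w := by linarith
    rcases hw0.eq_or_lt with hw00 | hwpos
    · have hz := (Finset.sum_eq_zero_iff_of_nonneg fun i _ => h0 i).1 (hw.trans hw00.symm)
      convert hmem a b hab (Or.inl rfl) using 1
      ext k
      rw [Pi.add_apply, Pi.single_apply, Pi.single_apply]
      by_cases hka : k = a
      · subst hka
        simp only [if_true, if_neg hab]
        linarith
      by_cases hkb : k = b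
      · subst hkb
        simp only [if_true, if_neg hka]
        linarith
      rw [hz k (by simp [hR, hka, hkb])]
      simp [hka, hkb]
    -- `v` is `1 - w` times `e_a + e_b` plus `w` times this point. The inner weights sum to one as
    -- `(1 - v b) + (1 - v a) = w`, and they are chosen so that coordinate `a` is `(1 - w) + (1 - v
    -- b) = v a`.
    · have key : ∑ i ∈ R, (v i / w) • (((1 - v b) / w) • (Pi.single a 1 + Pi.single i 1 : ι → ℝ) +
          ((1 - v a) / w) • (Pi.single b 1 + Pi.single i 1 : ι → ℝ)) ∈ convexHull ℝ S := by
        refine hconv.sum_mem (fun i _ => div_nonneg (h0 i) hw0) ?_ ?_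
        · rw [← Finset.sum_div, hw, div_self hwpos.ne']
        · intro i hi
          refine hconv (hmem a i (hRab i hi).1.symm (Or.inl rfl))
            (hmem b i (hRab i hi).2.symm (Or.inr rfl)) (div_nonneg (by linarith) hw0)
            (div_nonneg (by linarith) hw0) ?_
          rw [← add_div, div_eq_one_iff_eq hwpos.ne']
          ring
      have hfin := hconv (hmem a b hab (Or.inl rfl)) key (a := 1 - w) (b := w) (by linarith) hw0
        (by ring)
      convert hfin using 1
      have hsplit : ∀ i ∈ R, (v i / w) • (((1 - v b) / w) •
          (Pi.single a 1 + Pi.single i 1 : ι → ℝ) +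
          ((1 - v a) / w) • (Pi.single b 1 + Pi.single i 1 : ι → ℝ)) =
          v i • ((1 - v b) / w ^ 2) • (Pi.single a 1 : ι → ℝ) +
            v i • ((1 - v a) / w ^ 2) • (Pi.single b 1 : ι → ℝ) +
            (1 / w) • v i • (Pi.single i 1 : ι → ℝ) := by
        intro i _
        ext k
        simp only [Pi.add_apply, Pi.smul_apply, smul_eq_mul]
        field_simp
        ring
      rw [Finset.sum_congr rfl hsplit, Finset.sum_add_distrib, Finset.sum_add_distrib,
        ← Finset.sum_smul, ← Finset.sum_smul, ← Finset.smul_sum, hw]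
      ext k
      simp only [Pi.add_apply, Pi.smul_apply, smul_eq_mul, Finset.sum_apply, Pi.single_apply,
        mul_ite, mul_one, mul_zero, Finset.sum_ite_eq]
      by_cases hka : k = a
      · subst hka
        have hkR : k ∉ R := fun h => (hRab k h).1 rfl
        simp only [if_true, if_neg hab, if_neg hkR]
        field_simp
        ring
      by_cases hkb : k = b
      · subst hkb
        have hkR : k ∉ R := fun h => (hRab k h).2 rfl
        simp only [if_true, if_neg hka, if_neg hkR]
        field_simp
        ring
      have hkR : k ∈ R := by simp [hR, hka, hkb]
      simp only [if_neg hka, if_neg hkb, if_pos hkR]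
      field_simp
      ring

/-- The lattice points of the `m`-th dilate of the convex hull of the vectors `e i + e j`,
`i ∈ {a, b}`, `j ≠ i`. -/
theorem latticePointCount_smul_convexHull {ι : Type*} [Fintype ι] [DecidableEq ι] {a b : ι}
    (hab : a ≠ b) {r : ℕ} (hι : Fintype.card ι = r + 3) {m : ℕ} (hm : 0 < m) :
    latticePointCount ((m : ℝ) • convexHull ℝ {v : ι → ℝ | ∃ i j, i ≠ j ∧ (i = a ∨ i = b) ∧
      v = Pi.single i 1 + Pi.single j 1}) =
    ∑ s ∈ Finset.range (m + 1), (s + 1) * (s + r).choose r := by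
  have hm' : (0 : ℝ) < m := by exact_mod_cast hm
  set R : Finset ι := Finset.univ \ {a, b} with hR
  have haR : a ∉ R := by simp [hR]
  have hbR : b ∉ R := by simp [hR]
  have hmemR : ∀ i, i ∉ R → i = a ∨ i = b := by
    intro i hi
    simpa [hR, or_iff_not_imp_left] using hi
  have hRcard : R.card = r + 1 := by
    rw [hR, Finset.card_sdiff_of_subset (Finset.subset_univ _), Finset.card_univ, hι,
      Finset.card_pair hab]
    omega
  have hsumR : ∀ z : ι → ℤ, ∑ i, z i = ∑ i ∈ R, z i + (z a + z b) := by
    intro z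
    rw [← Finset.sum_sdiff (Finset.subset_univ ({a, b} : Finset ι)), Finset.sum_pair hab]
  -- A lattice point is encoded by its mass `s` off `{a, b}`, the deficit `t = m - z b`, and its
  -- values on `R`. Then `z a = m - s + t`, so `z a ≤ m` becomes `t ≤ s`, and `m ≤ z a + z b`
  -- becomes `s ≤ m`.
  let F : Finset (Σ _ : ℕ, ℕ × (ι → ℕ)) := (Finset.range (m + 1)).sigma fun s =>
    Finset.range (s + 1) ×ˢ Finset.piAntidiag R s
  let f : (Σ _ : ℕ, ℕ × (ι → ℕ)) → ι → ℤ := fun x i =>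
    if i = a then m - x.1 + x.2.1 else if i = b then m - x.2.1 else x.2.2 i
  have hfa : ∀ x, f x a = m - x.1 + x.2.1 := fun x => if_pos rfl
  have hfb : ∀ x, f x b = m - x.2.1 := fun x => (if_neg hab.symm).trans (if_pos rfl)
  have hfR : ∀ x, ∀ i ∈ R, f x i = x.2.2 i := fun x i hi =>
    (if_neg (ne_of_mem_of_not_mem hi haR)).trans (if_neg (ne_of_mem_of_not_mem hi hbR))
  have hF : F.card = ∑ s ∈ Finset.range (m + 1), (s + 1) * (s + r).choose r := by
    rw [Finset.card_sigma]
    refine Finset.sum_congr rfl fun s _ => ?_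
    rw [Finset.card_product, Finset.card_range, card_piAntidiag_eq_choose R hRcard]
  rw [← hF, ← Set.ncard_coe_finset, ← Set.InjOn.ncard_image (f := f)]
  · rw [convexHull_single_add_single hab]
    unfold latticePointCount
    congr 1
    ext z
    have hscale : (fun i => (z i : ℝ)) ∈ (m : ℝ) • {v : ι → ℝ | (∀ i, 0 ≤ v i) ∧ v a ≤ 1 ∧
        v b ≤ 1 ∧ ∑ i, v i = 2 ∧ 1 ≤ v a + v b} ↔
        (∀ i, 0 ≤ z i) ∧ z a ≤ m ∧ z b ≤ m ∧ ∑ i, z i = 2 * m ∧ (m : ℤ) ≤ z a + z b := by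
      simp only [Set.mem_smul_set_iff_inv_smul_mem₀ hm'.ne', Set.mem_ofPred_eq, Pi.smul_apply,
        smul_eq_mul, ← Finset.mul_sum, mul_nonneg_iff_of_pos_left (inv_pos.2 hm'), ← mul_add,
        inv_mul_le_iff₀ hm', le_inv_mul_iff₀ hm', inv_mul_eq_iff_eq_mul₀ hm'.ne', mul_one]
      rw [mul_comm (2 : ℤ)]
      norm_cast
    rw [Set.mem_ofPred_eq, hscale]
    constructor
    · rintro ⟨h0, ha, hb, hs, hle⟩
      rw [hsumR] at hs
      refine ⟨⟨(2 * m - z a - z b).toNat, (m - z b).toNat,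
        fun i => if i ∈ R then (z i).toNat else 0⟩, ?_, ?_⟩
      · have hsum : ((∑ i ∈ R, if i ∈ R then (z i).toNat else 0 : ℕ) : ℤ) = ∑ i ∈ R, z i := by
          rw [Nat.cast_sum]
          refine Finset.sum_congr rfl fun i hi => ?_
          rw [if_pos hi, Int.toNat_of_nonneg (h0 i)]
        simp only [F, Finset.mem_coe, Finset.mem_sigma, Finset.mem_range, Finset.mem_product,
          Finset.mem_piAntidiag]
        have := h0 a
        refine ⟨by omega, by omega, by omega, fun i hi => ?_⟩
        by_contra h
        exact hi (if_neg h)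
      · ext i
        by_cases hi : i ∈ R
        · rw [hfR _ i hi]
          simp only [if_pos hi]
          exact Int.toNat_of_nonneg (h0 i)
        · rcases hmemR i hi with rfl | rfl
          · rw [hfa]; dsimp only; omega
          · rw [hfb]; dsimp only; omega
    · rintro ⟨⟨s, t, g⟩, hx, rfl⟩
      simp only [F, Finset.mem_coe, Finset.mem_sigma, Finset.mem_range, Finset.mem_product,
        Finset.mem_piAntidiag] at hx
      obtain ⟨hs, ht, hg, -⟩ := hx
      rw [hsumR, hfa, hfb, Finset.sum_congr rfl (hfR _)]
      dsimp only
      rw [← Nat.cast_sum, hg]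
      refine ⟨fun i => ?_, by omega, by omega, by omega, by omega⟩
      by_cases hi : i ∈ R
      · rw [hfR _ i hi]; positivity
      · rcases hmemR i hi with rfl | rfl
        · rw [hfa]; dsimp only; omega
        · rw [hfb]; dsimp only; omega
  · rintro ⟨s, t, g⟩ hx ⟨s', t', g'⟩ hx' h
    simp only [F, Finset.mem_coe, Finset.mem_sigma, Finset.mem_range, Finset.mem_product,
      Finset.mem_piAntidiag] at hx hx'
    have h1 := congrFun h a
    have h2 := congrFun h b
    rw [hfa, hfa] at h1
    rw [hfb, hfb] at h2
    dsimp only at h1 h2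
    obtain rfl : t = t' := by omega
    obtain rfl : s = s' := by omega
    obtain rfl : g = g' := by
      ext i
      by_cases hi : i ∈ R
      · have h3 := congrFun h i
        rw [hfR _ i hi, hfR _ i hi] at h3
        exact_mod_cast h3
      · rw [not_not.1 (mt (hx.2.2.2 i) hi), not_not.1 (mt (hx'.2.2.2 i) hi)]
    rfl

/-! ### Complete multipartite graphs with few edges -/

/-- A complete multipartite graph with a triangle on `n ≥ 4` vertices and at most `2 n - 3` edges
consists of two adjacent vertices that are joined to all other vertices. -/
theorem SimpleGraph.IsCompleteMultipartite.exists_adj_iff {V : Type*} [Fintype V] [DecidableEq V]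
    {G : SimpleGraph V} [DecidableRel G.Adj] (hG : G.IsCompleteMultipartite)
    (hV : 4 ≤ Fintype.card V) (hcard : G.edgeFinset.card + 3 ≤ 2 * Fintype.card V) {x y z : V}
    (hxy : G.Adj x y) (hxz : G.Adj x z) (hyz : G.Adj y z) :
    ∃ a b, a ≠ b ∧ ∀ i j, G.Adj i j ↔ i ≠ j ∧ ((i = a ∨ i = b) ∨ (j = a ∨ j = b)) := by
  have htrans : ∀ {u v w}, ¬ G.Adj u v → ¬ G.Adj v w → ¬ G.Adj u w := fun h1 h2 =>
    hG.trans _ _ _ h1 h2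
  set T : Finset V := {x, y, z} with hT
  have hTcard : T.card = 3 := Finset.card_eq_three.2 ⟨x, y, z, hxy.ne, hxz.ne, hyz.ne, rfl⟩
  -- The triangle meets three distinct parts, and `w` shares a part with at most one of its
  -- vertices.
  have htwo : ∀ w, ∃ a ∈ T, ∃ b ∈ T, G.Adj a b ∧ G.Adj w a ∧ G.Adj w b := by
    intro w
    by_cases h1 : G.Adj w x
    · by_cases h2 : G.Adj w y
      · exact ⟨x, by simp [hT], y, by simp [hT], hxy, h1, h2⟩
      · have h3 : G.Adj w z := by
          by_contra h3
          exact htrans (fun h => h2 h.symm) h3 hyz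
        exact ⟨x, by simp [hT], z, by simp [hT], hxz, h1, h3⟩
    · have h2 : G.Adj w y := by
        by_contra h2
        exact htrans (fun h => h1 h.symm) h2 hxy
      have h3 : G.Adj w z := by
        by_contra h3
        exact htrans (fun h => h1 h.symm) h3 hxz
      exact ⟨y, by simp [hT], z, by simp [hT], hyz, h2, h3⟩
  -- Otherwise the degree sum is at least `2n` on `T` (by `htwo`, double counting) plus `3(n - 3)`
  -- off `T`, that is `5n - 9`. This exceeds `2(2n - 3)` when `n ≥ 4`.
  have hdeg : ∃ w, G.degree w ≤ 2 := by
    by_contra! hall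
    have hsum := G.sum_degrees_eq_twice_card_edges
    have hT2 : 2 * Fintype.card V ≤ ∑ t ∈ T, G.degree t := by
      have h1 : ∑ t ∈ T, G.degree t = ∑ w : V, (T.filter (G.Adj w)).card := by
        simp only [← G.card_neighborFinset_eq_degree, SimpleGraph.neighborFinset_eq_filter,
          Finset.card_filter]
        rw [Finset.sum_comm]
        simp only [G.adj_comm]
      rw [h1, mul_comm, ← smul_eq_mul, ← Finset.card_univ]
      refine Finset.card_nsmul_le_sum _ _ _ fun w _ => ?_
      obtain ⟨a, ha, b, hb, hab, hwa, hwb⟩ := htwo w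
      refine Finset.one_lt_card.2 ⟨a, ?_, b, ?_, hab.ne⟩
      · exact Finset.mem_filter.2 ⟨ha, hwa⟩
      · exact Finset.mem_filter.2 ⟨hb, hwb⟩
    have hW : (Fintype.card V - 3) * 3 ≤ ∑ w ∈ Finset.univ \ T, G.degree w := by
      rw [← hTcard, ← Finset.card_univ, ← Finset.card_sdiff_of_subset (Finset.subset_univ T),
        hTcard, ← smul_eq_mul]
      exact Finset.card_nsmul_le_sum _ _ _ fun w _ => hall w
    have := Finset.sum_sdiff (Finset.subset_univ T) (f := fun w => G.degree w)
    omega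
  obtain ⟨w, hw⟩ := hdeg
  obtain ⟨a, -, b, -, hab, hwa, hwb⟩ := htwo w
  have hN : G.neighborFinset w = {a, b} := by
    symm
    apply Finset.eq_of_subset_of_card_le
    · intro c hc
      rw [Finset.mem_insert, Finset.mem_singleton] at hc
      rcases hc with rfl | rfl <;> simpa
    · rwa [Finset.card_pair hab.ne, G.card_neighborFinset_eq_degree]
  have hNw : ∀ c, G.Adj w c ↔ c = a ∨ c = b := by
    intro c
    rw [← G.mem_neighborFinset, hN, Finset.mem_insert, Finset.mem_singleton]
  -- Everything outside `{a, b}` lies in the part of `w`, hence is adjacent to `a` and `b`.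
  have hout : ∀ i j, ¬ (i = a ∨ i = b) → (j = a ∨ j = b) → G.Adj i j := by
    intro i j hi hj
    by_contra h
    exact htrans (mt (hNw i).1 hi) h ((hNw j).2 hj)
  refine ⟨a, b, hab.ne, fun i j => ⟨fun h => ⟨h.ne, ?_⟩, ?_⟩⟩
  · by_contra! hcon
    refine htrans (v := w) (fun h' => ?_) (fun h' => ?_) h
    · exact absurd ((hNw i).1 h'.symm) (by tauto)
    · exact absurd ((hNw j).1 h') (by tauto)
  · rintro ⟨hij, h⟩
    by_cases hi : i = a ∨ i = b
    · by_cases hj : j = a ∨ j = b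
      · rcases hi with rfl | rfl <;> rcases hj with rfl | rfl
        · exact absurd rfl hij
        · exact hab
        · exact hab.symm
        · exact absurd rfl hij
      · exact (hout j i hj hi).symm
    · exact hout i j hi (h.resolve_left hi)

/-! ### Matroids of rank two as graphs -/

/-- In a connected matroid with at least two elements every element is a nonloop. -/
theorem MatroidConnected.indep_singleton {α : Type*} {M : Matroid α} (hM : MatroidConnected M)
    (hE : M.E.Nontrivial) {x : α} (hx : x ∈ M.E) : M.Indep {x} := by
  obtain ⟨y, hy, hyx⟩ := hE.exists_ne x
  obtain ⟨C, hC, hxC, hyC⟩ := hM x hx y hy hyx.symm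
  refine hC.ssubset_indep ⟨Set.singleton_subset_iff.2 hxC, fun h => hyx ?_⟩
  exact h hyC

theorem Matroid.Indep.isBase_of_encard_eq_eRank {α : Type*} {M : Matroid α} {I : Set α} {k : ℕ}
    (hI : M.Indep I) (hk : M.eRank = k) (hIk : I.encard = k) : M.IsBase I := by
  obtain ⟨B, hB, hIB⟩ := hI.exists_isBase_superset
  have hBk : B.encard = k := hB.encard_eq_eRank.trans hk
  have hfin : B.Finite := Set.finite_of_encard_eq_coe hBk
  have hIB' : I = B := hfin.eq_of_subset_of_encard_le' hIB (by rw [hBk, hIk])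
  rwa [hIB']

/-- The graph whose edges are the two-element bases of a matroid. -/
def Matroid.baseGraph {α : Type*} (M : Matroid α) : SimpleGraph M.E where
  Adj x y := x ≠ y ∧ M.IsBase {(x : α), (y : α)}
  symm.symm x y h := ⟨h.1.symm, by rw [Set.pair_comm]; exact h.2⟩
  loopless.irrefl x h := h.1 rfl

/-- Augmenting `{y}` from a base `{x, z}` makes `{x, y}` or `{z, y}` a base, so non-adjacency is
transitive. -/
theorem Matroid.baseGraph_isCompleteMultipartite {α : Type*} {M : Matroid α} (hk : M.eRank = 2)
    (hloop : ∀ x ∈ M.E, M.Indep {x}) : M.baseGraph.IsCompleteMultipartite := by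
  refine ⟨fun x y z hxy hyz hxz => ?_⟩
  have hxz' : (x : α) ≠ z := fun h => hxz.1 (Subtype.ext h)
  obtain ⟨e, he, hei⟩ := (hloop y y.2).augment hxz.2.indep (by
    rw [Set.encard_singleton, Set.encard_pair hxz']; norm_num)
  have hbase : M.IsBase {e, (y : α)} := hei.isBase_of_encard_eq_eRank (k := 2) hk
    (Set.encard_pair he.2)
  have hey : e ≠ y := he.2
  rcases he.1 with rfl | rfl
  · exact hxy ⟨fun h => hey (congrArg _ h), hbase⟩
  · exact hyz ⟨fun h => hey (congrArg _ h.symm), by rw [Set.pair_comm]; exact hbase⟩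

theorem Matroid.card_edgeSet_baseGraph_le {α : Type*} {M : Matroid α} (hfin : M.E.Finite) :
    M.baseGraph.edgeSet.ncard ≤ {B : Set α | M.IsBase B}.ncard := by
  refine Set.ncard_le_ncard_of_injOn (fun e : Sym2 M.E => {a : α | ∃ h : a ∈ M.E, ⟨a, h⟩ ∈ e})
    ?_ ?_ (hfin.finite_subsets.subset fun B hB => hB.subset_ground)
  · intro e
    induction e with
    | h x y =>
      intro h
      have h' : M.IsBase {(x : α), (y : α)} := h.2
      refine Set.mem_ofPred_eq ▸ ?_
      convert h' using 1
      ext a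
      simp only [Sym2.mem_iff, Set.mem_ofPred_eq, Set.mem_insert_iff, Set.mem_singleton_iff,
        Subtype.ext_iff]
      constructor
      · rintro ⟨-, h⟩
        exact h
      · rintro (rfl | rfl)
        · exact ⟨x.2, Or.inl rfl⟩
        · exact ⟨y.2, Or.inr rfl⟩
  · intro e _ e' _ h
    ext x
    have := Set.ext_iff.1 h x
    simpa using this

/-- A circuit through both elements of a base has a third element; any two elements of it form a
proper, hence independent, subset of full rank. -/
theorem MatroidConnected.exists_triangle {α : Type*} {M : Matroid α} (hM : MatroidConnected M)
    (hk : M.eRank = 2) : ∃ x y z, M.baseGraph.Adj x y ∧ M.baseGraph.Adj x z ∧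
      M.baseGraph.Adj y z := by
  obtain ⟨B, hB⟩ := M.exists_isBase
  obtain ⟨x, y, hxy, rfl⟩ := Set.encard_eq_two.1 (hB.encard_eq_eRank.trans hk)
  have hx : x ∈ M.E := hB.subset_ground (by simp)
  have hy : y ∈ M.E := hB.subset_ground (by simp)
  obtain ⟨C, hC, hxC, hyC⟩ := hM x hx y hy hxy
  have hsub : ({x, y} : Set α) ⊆ C := Set.pair_subset hxC hyC
  obtain ⟨z, hzC, hz⟩ : ∃ z ∈ C, z ∉ ({x, y} : Set α) := by
    by_contra! h
    exact hC.not_indep (hB.indep.subset h)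
  have hzx : z ≠ x := fun h => hz (by simp [h])
  have hzy : z ≠ y := fun h => hz (by simp [h])
  have hbase : ∀ {u v w}, u ∈ C → v ∈ C → w ∈ C → u ≠ v → w ≠ u → w ≠ v →
      M.IsBase {u, v} := by
    intro u v w hu hv hw huv hwu hwv
    refine Matroid.Indep.isBase_of_encard_eq_eRank (k := 2) (hC.ssubset_indep ?_) hk
      (Set.encard_pair huv)
    refine ⟨Set.pair_subset hu hv, fun h => ?_⟩
    rcases h hw with h | h
    · exact hwu h
    · exact hwv h
  have hzE := hC.subset_ground hzC
  refine ⟨⟨x, hx⟩, ⟨y, hy⟩, ⟨z, hzE⟩, ⟨fun h => hxy (congrArg Subtype.val h), hB⟩,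
    ⟨fun h => hzx (congrArg Subtype.val h).symm, hbase hxC hzC hyC hzx.symm hxy.symm hzy.symm⟩,
    ⟨fun h => hzy (congrArg Subtype.val h).symm, hbase hyC hzC hxC hzy.symm hxy hzx.symm⟩⟩

/-- The base polytope of a matroid of rank two in terms of its graph of bases. -/
theorem basePolytope_eq_of_eRank_eq_two {α : Type*} {M : Matroid α} [DecidableEq M.E]
    (hk : M.eRank = 2) : basePolytope M = convexHull ℝ {v : M.E → ℝ | ∃ i j,
      M.baseGraph.Adj i j ∧ v = Pi.single i 1 + Pi.single j 1} := by
  unfold basePolytope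
  congr 1
  have hind : ∀ i j : M.E, i ≠ j → Set.indicator {e : M.E | (e : α) ∈ ({(i : α), (j : α)} : Set α)}
      (1 : M.E → ℝ) = Pi.single i 1 + Pi.single j 1 := by
    intro i j hij
    ext k
    simp only [Set.indicator_apply, Set.mem_ofPred_eq, Set.mem_insert_iff, Set.mem_singleton_iff,
      Pi.add_apply, Pi.single_apply, Pi.one_apply, ← Subtype.ext_iff]
    by_cases h1 : k = i
    · have h2 : k ≠ j := fun h => hij (h1.symm.trans h)
      simp [h1, hij]
    · simp [h1]
  ext v
  constructor
  · rintro ⟨B, hB, rfl⟩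
    obtain ⟨x, y, hxy, rfl⟩ := Set.encard_eq_two.1 (hB.encard_eq_eRank.trans hk)
    have hne : (⟨x, hB.subset_ground (by simp)⟩ : M.E) ≠ ⟨y, hB.subset_ground (by simp)⟩ :=
      fun h => hxy (congrArg Subtype.val h)
    exact ⟨_, _, ⟨hne, hB⟩, hind _ _ hne⟩
  · rintro ⟨i, j, hij, rfl⟩
    exact ⟨_, hij.2, (hind _ _ hij.1).symm⟩

/-! ### The m-indices in ranks two and one -/

theorem IsMinimalMatroid.mIndex_basePolytope_two {α : Type*} {M : Matroid α} {n : ℕ} (hn : 4 ≤ n)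
    (hM : IsMinimalMatroid M 2 n) : mIndex (basePolytope M) = n - 2 := by
  classical
  have hfin : M.E.Finite := Set.finite_of_encard_eq_coe hM.card_ground
  have : Fintype M.E := hfin.fintype
  have hcard : Fintype.card M.E = n := by
    have := hM.card_ground
    rw [← Set.coe_fintypeCard] at this
    exact_mod_cast this
  have hk : M.eRank = 2 := hM.rank_eq
  have hnt : M.E.Nontrivial := by
    rw [← Set.one_lt_encard_iff_nontrivial, hM.card_ground]
    exact_mod_cast (by omega : 1 < n)
  obtain ⟨x, y, z, hxy, hxz, hyz⟩ := hM.connected.exists_triangle hk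
  have hmulti := M.baseGraph_isCompleteMultipartite hk fun x hx =>
    hM.connected.indep_singleton hnt hx
  have hedges := M.card_edgeSet_baseGraph_le hfin
  rw [hM.card_bases, ← SimpleGraph.coe_edgeFinset, Set.ncard_coe_finset] at hedges
  obtain ⟨a, b, hab, hadj⟩ := hmulti.exists_adj_iff (by omega) (by omega) hxy hxz hyz
  obtain ⟨r, rfl⟩ : ∃ r, n = r + 3 := ⟨n - 3, by omega⟩
  have hpoly : basePolytope M = convexHull ℝ {v : M.E → ℝ | ∃ i j, i ≠ j ∧ (i = a ∨ i = b) ∧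
      v = Pi.single i 1 + Pi.single j 1} := by
    rw [basePolytope_eq_of_eRank_eq_two hk]
    congr 1
    ext v
    constructor
    · rintro ⟨i, j, hij, rfl⟩
      obtain ⟨hne, h | h⟩ := (hadj i j).1 hij
      · exact ⟨i, j, hne, h, rfl⟩
      · exact ⟨j, i, hne.symm, h, add_comm _ _⟩
    · rintro ⟨i, j, hij, h, rfl⟩
      exact ⟨i, j, (hadj i j).2 ⟨hij, Or.inl h⟩, rfl⟩
  rw [hpoly, show r + 3 - 2 = r + 1 by omega]
  -- This is where `n ≥ 4` matters: the extra slope needs `(r + 1)² ≥ r + 2`, which fails at `r =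
  -- 0`.
  have hr : (1 : ℝ) ≤ r := by exact_mod_cast (by omega : 1 ≤ r)
  refine mIndex_eq_of_prod _ (Finset.range (r + 2))
    (fun i => if i = r + 1 then ((r : ℝ) + 1) / (r + 2) else 1 / ((i : ℝ) + 1)) ?_ (by omega) ?_
    (j₀ := r) (by simp) ?_
  · intro m hm
    rw [latticePointCount_smul_convexHull hab hcard hm, sum_succ_mul_choose, choose_add_eq_prod,
      Finset.prod_range_succ _ (r + 1), if_pos rfl]
    congr 1
    refine Finset.prod_congr rfl fun i hi => ?_
    rw [if_neg (Finset.mem_range.1 hi).ne]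
  · intro i hi
    split_ifs with h
    · rw [← mul_div_assoc, le_div_iff₀ (by positivity)]
      push_cast
      nlinarith
    · have hi' : i + 1 ≤ r + 1 := by have := Finset.mem_range.1 hi; omega
      rw [mul_one_div, le_div_iff₀ (by positivity), one_mul]
      exact_mod_cast hi'
  · intro k hk
    rw [if_neg (by omega), mul_one_div, div_lt_one (by positivity)]
    exact_mod_cast hk

theorem IsMinimalMatroid.mIndex_basePolytope_one {α : Type*} {M : Matroid α} {n : ℕ} (hn : 2 ≤ n)
    (hM : IsMinimalMatroid M 1 n) : mIndex (basePolytope M) = n - 1 := by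
  classical
  have hfin : M.E.Finite := Set.finite_of_encard_eq_coe hM.card_ground
  have : Fintype M.E := hfin.fintype
  have hcard : Fintype.card M.E = n := by
    have := hM.card_ground
    rw [← Set.coe_fintypeCard] at this
    exact_mod_cast this
  have hk : M.eRank = 1 := by simpa using hM.rank_eq
  have hnt : M.E.Nontrivial := by
    rw [← Set.one_lt_encard_iff_nontrivial, hM.card_ground]
    exact_mod_cast (by omega : 1 < n)
  have hind : ∀ i : M.E, Set.indicator {e : M.E | (e : α) ∈ ({(i : α)} : Set α)}
      (1 : M.E → ℝ) = Pi.single i 1 := by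
    intro i
    ext k
    simp only [Set.indicator_apply, Set.mem_ofPred_eq, Set.mem_singleton_iff,
      Pi.single_apply, Pi.one_apply, ← Subtype.ext_iff]
  have hpoly : basePolytope M = stdSimplex ℝ M.E := by
    rw [← convexHull_rangle_single_eq_stdSimplex]
    unfold basePolytope
    congr 1
    ext v
    constructor
    · rintro ⟨B, hB, rfl⟩
      obtain ⟨x, rfl⟩ := Set.encard_eq_one.1 (hB.encard_eq_eRank.trans hk)
      exact ⟨⟨x, hB.subset_ground rfl⟩, (hind ⟨x, hB.subset_ground rfl⟩).symm⟩
    · rintro ⟨i, rfl⟩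
      exact ⟨{(i : α)}, (hM.connected.indep_singleton hnt i.2).isBase_of_encard_eq_eRank (k := 1)
        (by simpa using hk) (by simp), (hind i).symm⟩
  obtain ⟨r, rfl⟩ : ∃ r, n = r + 2 := ⟨n - 2, by omega⟩
  rw [hpoly, show r + 2 - 1 = r + 1 by omega]
  refine mIndex_eq_of_prod _ (Finset.range (r + 1)) (fun i => 1 / ((i : ℝ) + 1)) ?_ (by omega) ?_
    (j₀ := r) (by simp) ?_
  · intro m hm
    rw [latticePointCount_smul_stdSimplex hcard hm, choose_add_eq_prod]
  · intro i hi
    have hi' : i + 1 ≤ r + 1 := by have := Finset.mem_range.1 hi; omega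
    rw [mul_one_div, le_div_iff₀ (by positivity), one_mul]
    exact_mod_cast hi'
  · intro k hk
    rw [mul_one_div, div_lt_one (by positivity)]
    exact_mod_cast hk

/-! ### Existence of minimal matroids -/

theorem exists_isMinimalMatroid_one {α : Type*} [Fintype α] [Nonempty α] :
    ∃ M : Matroid α, IsMinimalMatroid M 1 (Fintype.card α) := by
  classical
  let M : Matroid α := Matroid.ofIsBaseOfFinite (E := Set.univ) Set.finite_univ
    (fun B => ∃ i, B = {i}) ⟨{Classical.arbitrary α}, _, rfl⟩ (by
      rintro _ _ ⟨i, rfl⟩ ⟨j, rfl⟩ e ⟨rfl, he⟩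
      exact ⟨j, ⟨rfl, fun h => he h.symm⟩, j, by simp⟩) (fun _ _ => Set.subset_univ _)
  have hbase : ∀ B, M.IsBase B ↔ ∃ i, B = {i} := fun B => Iff.rfl
  refine ⟨M, ?_, ?_, ?_, ?_⟩
  · change (Set.univ : Set α).encard = _
    rw [Set.encard_univ, ENat.card_eq_coe_fintype_card]
  · rw [← ((hbase {Classical.arbitrary α}).2 ⟨_, rfl⟩).encard_eq_eRank]
    simp
  · intro x _ y _ hxy
    refine ⟨{x, y}, ?_, by simp, by simp⟩
    rw [Matroid.isCircuit_iff_dep_forall_sdiff_singleton_indep]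
    refine ⟨⟨?_, Set.subset_univ _⟩, ?_⟩
    · rw [Matroid.indep_iff]
      rintro ⟨B, hB, hsub⟩
      obtain ⟨i, rfl⟩ := (hbase B).1 hB
      exact hxy ((hsub (by simp : x ∈ _)).trans (hsub (by simp : y ∈ _)).symm)
    · rintro e (rfl | rfl)
      · exact ((hbase _).2 ⟨y, by simp [Set.insert_sdiff_of_mem, hxy]⟩).indep
      · exact ((hbase _).2 ⟨x, by ext k; simp; grind⟩).indep
  · have : {B : Set α | M.IsBase B} = (fun i => ({i} : Set α)) '' Set.univ := by
      ext B
      simp [hbase, eq_comm]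
    rw [this, Set.ncard_image_of_injective _ Set.singleton_injective, Set.ncard_univ,
      Nat.card_eq_fintype_card]
    have := Fintype.card_pos (α := α)
    omega

/-- The bases are the pairs meeting a fixed `{a, b}`; the remaining elements form one parallel
class. -/
theorem exists_isMinimalMatroid_two {α : Type*} [Fintype α] (hα : 3 ≤ Fintype.card α) :
    ∃ M : Matroid α, IsMinimalMatroid M 2 (Fintype.card α) := by
  classical
  obtain ⟨a, b, c, hab, hac, hbc⟩ := Fintype.two_lt_card_iff.1 hα
  let M : Matroid α := Matroid.ofIsBaseOfFinite (E := Set.univ) Set.finite_univ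
    (fun B => ∃ i j, i ≠ j ∧ (i = a ∨ i = b) ∧ B = {i, j}) ⟨{a, b}, a, b, hab, Or.inl rfl, rfl⟩ (by
      rintro _ _ ⟨i, j, hij, hi, rfl⟩ ⟨p, q, hpq, hp, rfl⟩ e ⟨he, he'⟩
      have hmain : ∀ i j, (i ≠ j ∧ (i = a ∨ i = b)) ∨ (j ≠ i ∧ (j = a ∨ j = b)) →
          ∃ x y, x ≠ y ∧ (x = a ∨ x = b) ∧ ({i, j} : Set α) = {x, y} := by
        rintro i j (h | h)
        · exact ⟨i, j, h.1, h.2, rfl⟩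
        · exact ⟨j, i, h.1, h.2, Set.pair_comm _ _⟩
      obtain ⟨d, hde, hd, hed⟩ : ∃ d, d ≠ e ∧ (e = a ∨ e = b ∨ d = a ∨ d = b) ∧
          ({i, j} : Set α) = {e, d} := by
        rcases he with rfl | rfl
        · exact ⟨j, hij.symm, by tauto, rfl⟩
        · exact ⟨i, hij, by tauto, Set.pair_comm _ _⟩
      -- Take `f = p`, which lies in `{a, b}`. If `p = d`, take `q` instead, since then `d` lies in
      -- `{a, b}`.
      obtain ⟨f, hf, hfe, hfd, h⟩ : ∃ f ∈ ({p, q} : Set α), f ≠ e ∧ f ≠ d ∧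
          (f = a ∨ f = b ∨ d = a ∨ d = b) := by
        simp only [Set.mem_insert_iff, Set.mem_singleton_iff, not_or] at he'
        by_cases hpd : p = d
        · exact ⟨q, by simp, by grind⟩
        · exact ⟨p, by simp, by grind⟩
      rw [hed]
      refine ⟨f, ⟨hf, by simp [hfe, hfd]⟩, ?_⟩
      rw [Set.insert_sdiff_of_mem _ (Set.mem_singleton e),
        Set.sdiff_singleton_eq_self (by simpa using hde.symm)]
      exact hmain f d (by grind)) (fun _ _ => Set.subset_univ _)
  have hbase : ∀ B, M.IsBase B ↔ ∃ i j, i ≠ j ∧ (i = a ∨ i = b) ∧ B = {i, j} := fun B => Iff.rfl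
  have hpair : ∀ i j, i ≠ j → (i = a ∨ i = b ∨ j = a ∨ j = b) → M.IsBase {i, j} := by
    intro i j hij h
    by_cases hi : i = a ∨ i = b
    · exact (hbase _).2 ⟨i, j, hij, hi, rfl⟩
    · exact (hbase _).2 ⟨j, i, hij.symm, by tauto, Set.pair_comm _ _⟩
  refine ⟨M, ?_, ?_, ?_, ?_⟩
  · change (Set.univ : Set α).encard = _
    rw [Set.encard_univ, ENat.card_eq_coe_fintype_card]
  · rw [← (hpair a b hab (Or.inl rfl)).encard_eq_eRank, Set.encard_pair hab]
    rfl
  · intro x _ y _ hxy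
    by_cases h : x = a ∨ x = b ∨ y = a ∨ y = b
    -- `z` completes a triangle: an element of `{a, b}` other than `x, y`, or `c` if `{x, y} = {a,
    -- b}`.
    · obtain ⟨z, hzx, hzy, hz1, hz2⟩ : ∃ z, z ≠ x ∧ z ≠ y ∧
          (x = a ∨ x = b ∨ z = a ∨ z = b) ∧ (y = a ∨ y = b ∨ z = a ∨ z = b) := by
        by_cases h1 : x = a ∨ y = a
        · by_cases h2 : x = b ∨ y = b
          · exact ⟨c, by grind⟩
          · exact ⟨b, by grind⟩
        · exact ⟨a, by grind⟩
      refine ⟨{x, y, z}, ?_, by simp, by simp⟩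
      rw [Matroid.isCircuit_iff_dep_forall_sdiff_singleton_indep]
      refine ⟨⟨?_, Set.subset_univ _⟩, ?_⟩
      · rw [Matroid.indep_iff]
        rintro ⟨B, hB, hsub⟩
        obtain ⟨i, j, hij, hi, rfl⟩ := (hbase B).1 hB
        have h1 := hsub (by simp : x ∈ _)
        have h2 := hsub (by simp : y ∈ _)
        have h3 := hsub (by simp : z ∈ _)
        simp only [Set.mem_insert_iff, Set.mem_singleton_iff] at h1 h2 h3
        grind
      · rintro e (rfl | rfl | rfl)
        · convert (hpair y z hzy.symm hz2).indep using 1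
          ext k; simp; grind
        · convert (hpair x z hzx.symm hz1).indep using 1
          ext k; simp; grind
        · convert (hpair x y hxy h).indep using 1
          ext k; simp; grind
    · refine ⟨{x, y}, ?_, by simp, by simp⟩
      rw [Matroid.isCircuit_iff_dep_forall_sdiff_singleton_indep]
      refine ⟨⟨?_, Set.subset_univ _⟩, ?_⟩
      · rw [Matroid.indep_iff]
        rintro ⟨B, hB, hsub⟩
        obtain ⟨i, j, hij, hi, rfl⟩ := (hbase B).1 hB
        have h1 := hsub (by simp : x ∈ _)
        have h2 := hsub (by simp : y ∈ _)
        simp only [Set.mem_insert_iff, Set.mem_singleton_iff] at h1 h2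
        grind
      · rintro e (rfl | rfl)
        · refine (hpair a y (by grind) (Or.inl rfl)).indep.subset ?_
          intro k; simp; grind
        · refine (hpair a x (by grind) (Or.inl rfl)).indep.subset ?_
          intro k; simp; grind
  · have hinj : ∀ {i j k : α}, ({i, j} : Set α) = {i, k} → j = k := by
      intro i j k h
      have h1 : j ∈ ({i, k} : Set α) := h ▸ (by simp)
      have h2 : k ∈ ({i, j} : Set α) := h ▸ (by simp)
      simp only [Set.mem_insert_iff, Set.mem_singleton_iff] at h1 h2
      grind
    set R : Finset α := Finset.univ \ {a, b} with hR
    have hmem : ∀ i, i ∈ R ↔ i ≠ a ∧ i ≠ b := by intro i; simp [hR]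
    -- There are `n - 1` pairs through `a` and `n - 2` through `b` avoiding `a`: in all `2(n - 2) +
    -- 1`.
    have hset : {B : Set α | M.IsBase B} = ((Finset.univ.erase a).image (fun i => ({a, i} : Set α)) ∪
        R.image (fun i => ({b, i} : Set α)) : Finset (Set α)) := by
      ext B
      simp only [Set.mem_ofPred_eq, hbase, Finset.coe_union, Finset.coe_image, Set.mem_union,
        Set.mem_image, Finset.mem_coe, Finset.mem_erase, Finset.mem_univ, and_true, hmem]
      constructor
      · rintro ⟨i, j, hij, rfl | rfl, rfl⟩
        · exact Or.inl ⟨j, hij.symm, rfl⟩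
        · by_cases hj : j = a
          · subst hj
            exact Or.inl ⟨i, hij, Set.pair_comm _ _⟩
          · exact Or.inr ⟨j, ⟨hj, hij.symm⟩, rfl⟩
      · rintro (⟨j, hj, rfl⟩ | ⟨j, hj, rfl⟩)
        · exact ⟨a, j, hj.symm, Or.inl rfl, rfl⟩
        · exact ⟨b, j, hj.2.symm, Or.inr rfl, rfl⟩
    rw [hset, Set.ncard_coe_finset, Finset.card_union_of_disjoint,
      Finset.card_image_of_injective _ fun _ _ => hinj,
      Finset.card_image_of_injective _ fun _ _ => hinj, Finset.card_erase_of_mem (Finset.mem_univ a),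
      hR, Finset.card_sdiff_of_subset (Finset.subset_univ _), Finset.card_pair hab,
      Finset.card_univ]
    · omega
    · rw [Finset.disjoint_left]
      intro B h1 h2
      obtain ⟨i, -, rfl⟩ := Finset.mem_image.1 h1
      obtain ⟨j, hj, h⟩ := Finset.mem_image.1 h2
      have ha : a ∈ ({b, j} : Set α) := h ▸ (by simp)
      rw [hmem] at hj
      rcases ha with rfl | rfl
      · exact hab rfl
      · exact hj.1 rfl

theorem mainTheorem5 :
    (∀ n : ℕ, 2 ≤ n →
      (∃ M : Matroid (Fin n), IsMinimalMatroid M 1 n) ∧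
      ∀ (α : Type u) (M : Matroid α), IsMinimalMatroid M 1 n →
        mIndex (basePolytope M) = n - 1) ∧
    (∀ n : ℕ, 4 ≤ n →
      (∃ M : Matroid (Fin n), IsMinimalMatroid M 2 n) ∧
      ∀ (α : Type u) (M : Matroid α), IsMinimalMatroid M 2 n →
        mIndex (basePolytope M) = n - 2) := by
  refine ⟨fun n hn => ⟨?_, fun α M hM => hM.mIndex_basePolytope_one hn⟩,
    fun n hn => ⟨?_, fun α M hM => hM.mIndex_basePolytope_two hn⟩⟩
  · have : NeZero n := ⟨by omega⟩
    simpa using exists_isMinimalMatroid_one (α := Fin n)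
  · simpa using exists_isMinimalMatroid_two (α := Fin n) (by simp; omega)
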